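/- Let $\Gamma$ be an irreducible cubic curve in the real projective plane (for instance a nonsingular one). For nonsingular points $P,Q$ of $\Gamma$ let $PQ$ denote the line through $P$ and $Q$ if $P\neq Q$, and the tangent to $\Gamma$ at $P$ if $P=Q$; let $P\#Q$ be the third intersection point, counted with multiplicity, of $PQ$ with $\Gamma$. For two distinct lines $\ell,m$ let $\ell\wedge m$ be their intersection point. (a) Let $P,Q,\bar P,\bar Q$ be pairwise distinct nonsingular points of $\Gamma$, and suppose that $S:=PQ\wedge\bar P\bar Q$ and $\bar S:=P\bar Q\wedge\bar PQ$ lie on $\Gamma$. If $S$ is one of the four points $P,Q,\bar P,\bar Q$, suppose in addition that $S=P\#Q=\bar P\#\bar Q$; if $\bar S$ is one of these four points, suppose in addition that $\bar S=P\#\bar Q=\bar P\#Q$. (If no three of the four points are collinear, neither case occurs.) Then $S$ and $\bar S$ are nonsingular points of $\Gamma$, and $P\#P=\bar P\#\bar P\in\Gamma$, $Q\#Q=\bar Q\#\bar Q\in\Gamma$ and $S\#S=\bar S\#\bar S\in\Gamma$. (b) Conversely, let $P,\bar P$ be nonsingular points of $\Gamma$ with $P\#P=\bar P\#\bar P$.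 Let $Q$ be any nonsingular point of $\Gamma$, and put $S:=P\#Q$ and $\bar Q:=S\#\bar P$. Then $\bar Q$ is a nonsingular point of $\Gamma$, $P\#\bar Q=\bar P\#Q=:\bar S\in\Gamma$, and $Q\#Q=\bar Q\#\bar Q\in\Gamma$. If moreover $P\neq\bar P$ and $Q\neq P$, then the lines $P\bar Q$ and $\bar PQ$ are distinct and $\bar S=P\bar Q\wedge\bar PQ$. -/

import Mathlib

open scoped LinearAlgebra.Projectivization

/-- The real projective plane. -/
abbrev RealPlane : Type := ℙ ℝ (Fin 3 → ℝ)

/-- An irreducible cubic curve in the real projective plane, given by its defining form. -/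
structure PlaneCubic where
  /-- the defining ternary form -/
  form : MvPolynomial (Fin 3) ℝ
  homogeneous : form.IsHomogeneous 3
  irreducible : Irreducible form

namespace PlaneCubic

noncomputable section

/-- The set of (real) points of the curve. As the form is homogeneous, the choice of the
representative is immaterial here and below. -/
def points (Γ : PlaneCubic) : Set RealPlane :=
  {P | MvPolynomial.eval P.rep Γ.form = 0}

/-- The gradient of the defining form at (a representative of) `P`. -/
def gradient (Γ : PlaneCubic) (P : RealPlane) : Fin 3 → ℝ :=
  fun i => MvPolynomial.eval P.rep (MvPolynomial.pderiv i Γ.form)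

/-- The set of nonsingular points of the curve. -/
def regularPoints (Γ : PlaneCubic) : Set RealPlane :=
  {P | P ∈ Γ.points ∧ Γ.gradient P ≠ 0}

/-- The tangent line of the curve at a nonsingular point `P`; lines of the projective plane are
regarded as two-dimensional linear subspaces of `ℝ³`. -/
def tangent (Γ : PlaneCubic) (P : RealPlane) : Submodule ℝ (Fin 3 → ℝ) :=
  LinearMap.ker (∑ i, Γ.gradient P i • (LinearMap.proj i : (Fin 3 → ℝ) →ₗ[ℝ] ℝ))

open Classical in
/-- The line `PQ`: the join of `P` and `Q` if `P ≠ Q`, and the tangent at `P` if `P = Q`. -/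
def line (Γ : PlaneCubic) (P Q : RealPlane) : Submodule ℝ (Fin 3 → ℝ) :=
  if P = Q then Γ.tangent P else P.submodule ⊔ Q.submodule

/-- `Γ.IsSharp P Q R` says that `R = P # Q`: the line `PQ` does not lie in the curve, and its three
intersection points with the curve, counted with multiplicity, are `P`, `Q` and `R`. That is, the
restriction of the cubic form to the line is a nonzero product of three linear forms, whose zeros on
the line are the points `P`, `Q` and `R`, respectively. -/
def IsSharp (Γ : PlaneCubic) (P Q R : RealPlane) : Prop :=
  R.submodule ≤ Γ.line P Q ∧
  (∃ v ∈ Γ.line P Q, MvPolynomial.eval v Γ.form ≠ 0) ∧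
  ∃ a b c : Module.Dual ℝ (Fin 3 → ℝ),
    a P.rep = 0 ∧ b Q.rep = 0 ∧ c R.rep = 0 ∧
    ∀ v ∈ Γ.line P Q, MvPolynomial.eval v Γ.form = a v * b v * c v

end

end PlaneCubic

/-- `S = L ∧ M`: the lines `L` and `M` have exactly the point `S` in common. -/
def IsMeet (L M : Submodule ℝ (Fin 3 → ℝ)) (S : RealPlane) : Prop :=
  L ⊓ M = S.submodule

/-! On nonsingular points, `#` is commutative, satisfies P#(P#Q) = Q, and obeys the medial law
(A#B)#(C#D) = (A#C)#(B#D). Everything else is formal. For (a), (P#P)#(Q#Q') = (P#Q)#(P#Q') =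
(P'#Q')#(P'#Q) = (P'#P')#(Q#Q'), and Q#Q' cancels; S#S and S'#S' both equal (P#P')#(Q#Q'). For (b),
(P#P')#(P#Q') = (P#P)#(P'#Q') = (P'#P')#(P#Q) = (P#P')#(P'#Q), and P#P' cancels.

The medial law (`IsSection.eq_of_medial`) comes from counting zeros with multiplicity, so A, B, C, D
may coincide. Multiplicity is the order of a form along a formal branch of the curve, which Hensel's
lemma provides (`exists_isBranch`). By a case of Noether's theorem
(`IsSection.exists_eq_mul_add_mul`), a form whose divisor contains a line section is divisible by
that line modulo the cubic. Dividing a product of four lines by three others leaves one line, whose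
divisor forces the two sides of the law to agree. -/

namespace MvPolynomial

/-! ### Substitution, homogeneous components and linear forms -/

theorem aeval_sub_aeval_mem {σ R S : Type*} [CommRing R] [CommRing S] [Algebra R S]
    (I : Ideal S) {f g : σ → S} (h : ∀ i, f i - g i ∈ I) (H : MvPolynomial σ R) :
    aeval f H - aeval g H ∈ I := by
  rw [← Ideal.Quotient.eq]
  have key : ∀ f : σ → S, Ideal.Quotient.mk I (aeval f H) =
      aeval (fun i => Ideal.Quotient.mk I (f i)) H := fun f => by
    rw [← Ideal.Quotient.mkₐ_eq_mk R, ← AlgHom.comp_apply, comp_aeval]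
  rw [key, key]
  congr 2
  funext i
  exact Ideal.Quotient.eq.2 (h i)

theorem eval_aeval {σ R : Type*} [CommRing R] (x : σ → R) (g : σ → MvPolynomial σ R)
    (H : MvPolynomial σ R) : eval x (aeval g H) = eval (fun i => eval x (g i)) H := by
  rw [← coe_aeval_eq_eval, ← coe_aeval_eq_eval, AlgHom.coe_toRingHom, ← AlgHom.comp_apply,
    comp_aeval]
  simp [coe_aeval_eq_eval]

theorem IsHomogeneous.eval_smul {σ R : Type*} [CommRing R] {H : MvPolynomial σ R} {n : ℕ}
    (hH : H.IsHomogeneous n) (c : R) (p : σ → R) :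
    eval (c • p) H = c ^ n * eval p H := by
  rw [eval_eq, eval_eq, Finset.mul_sum]
  refine Finset.sum_congr rfl fun d hd => ?_
  have hdeg := hH.degree_eq_sum_deg_support hd
  simp only [Pi.smul_apply, smul_eq_mul, mul_pow, Finset.prod_mul_distrib]
  rw [Finset.prod_pow_eq_pow_sum, ← hdeg]
  ring

-- Taking the degree-`m` part of an identity makes its cofactors homogeneous, so that degrees can be
-- counted.
attribute [local instance] MvPolynomial.gradedAlgebra in
theorem IsHomogeneous.exists_homogeneousComponent_mul {σ R : Type*} [CommRing R]
    {f : MvPolynomial σ R} {i : ℕ} (hf : f.IsHomogeneous i) (m : ℕ) (A : MvPolynomial σ R) :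
    ∃ B : MvPolynomial σ R, B.IsHomogeneous (m - i) ∧ homogeneousComponent m (f * A) = f * B := by
  have e : ∀ (x : MvPolynomial σ R) (j : ℕ),
      ((DirectSum.decompose (homogeneousSubmodule σ R) x j : _) : MvPolynomial σ R)
        = homogeneousComponent j x := fun x j => decomposition.decompose'_apply x j
  by_cases h : i ≤ m
  · refine ⟨homogeneousComponent (m - i) A, homogeneousComponent_isHomogeneous _ _, ?_⟩
    rw [← e, ← e, DirectSum.coe_decompose_mul_of_left_mem_of_le (homogeneousSubmodule σ R)
      ((mem_homogeneousSubmodule _ _).2 hf) h]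
  · refine ⟨0, isHomogeneous_zero _ _ _, ?_⟩
    rw [← e, DirectSum.coe_decompose_mul_of_left_mem_of_not_le (homogeneousSubmodule σ R)
      ((mem_homogeneousSubmodule _ _).2 hf) h, mul_zero]

/-- The linear polynomial with the same values as a linear functional. -/
noncomputable def linForm (a : Module.Dual ℝ (Fin 3 → ℝ)) : MvPolynomial (Fin 3) ℝ :=
  ∑ i, C (a (Pi.single i 1)) * X i

theorem isHomogeneous_linForm (a : Module.Dual ℝ (Fin 3 → ℝ)) : (linForm a).IsHomogeneous 1 :=
  IsHomogeneous.sum _ _ _ fun i _ => isHomogeneous_C_mul_X _ i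

theorem eval_linForm (a : Module.Dual ℝ (Fin 3 → ℝ)) (v : Fin 3 → ℝ) :
    eval v (linForm a) = a v := by
  conv_rhs => rw [pi_eq_sum_univ' v, map_sum]
  simp [linForm, mul_comm]

theorem exists_linForm_eq {H : MvPolynomial (Fin 3) ℝ} (hH : H.IsHomogeneous 1) :
    ∃ a, linForm a = H := by
  have h : H ∈ Submodule.span ℝ (Set.range (X : Fin 3 → MvPolynomial (Fin 3) ℝ)) := by
    rw [← homogeneousSubmodule_one_eq_span_X]
    exact hH
  obtain ⟨c, hc⟩ := (Submodule.mem_span_range_iff_exists_fun ℝ).1 h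
  refine ⟨∑ i, c i • LinearMap.proj i, ?_⟩
  refine MvPolynomial.funext fun x => ?_
  simp [eval_linForm, ← hc, smul_eval]

end MvPolynomial

/-! ### Forms vanishing at a point or on a line -/

open MvPolynomial

theorem exists_adapted_coordinates {l a : Module.Dual ℝ (Fin 3 → ℝ)} {p : Fin 3 → ℝ} (hp : p ≠ 0)
    (hl : l ≠ 0) (hlp : l p = 0) (hap : a p = 0) (h : ∃ v, l v = 0 ∧ a v ≠ 0) :
    ∃ (w e : Fin 3 → ℝ) (s : Module.Dual ℝ (Fin 3 → ℝ)), l w = 0 ∧ a w = 1 ∧ l e = 1 ∧ a e = 0 ∧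
      ∀ x, x = s x • p + a x • w + l x • e := by
  obtain ⟨v, hlv, hav⟩ := h
  obtain ⟨u, hu⟩ : ∃ u, l u ≠ 0 := by
    by_contra! h; exact hl (LinearMap.ext h)
  set w := (a v)⁻¹ • v with hw
  have hlw : l w = 0 := by simp [hw, hlv]
  have haw : a w = 1 := by simp [hw, hav]
  set e := (l u)⁻¹ • u - (a ((l u)⁻¹ • u)) • w with he
  have hle : l e = 1 := by simp [he, hu, hlw]
  have hae : a e = 0 := by simp [he, haw]
  have li : LinearIndependent ℝ ![p, w, e] := by
    rw [Fintype.linearIndependent_iff]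
    intro g hg
    simp only [Fin.sum_univ_three] at hg
    have h1 := congrArg a hg
    have h2 := congrArg l hg
    simp [hlw, haw, hle, hae, hlp, hap] at h1 h2
    simp [h1, h2, hp] at hg
    intro i
    fin_cases i <;> simp [hg, h1, h2]
  let b := basisOfLinearIndependentOfCardEqFinrank li (by simp)
  refine ⟨w, e, b.coord 0, hlw, haw, hle, hae, fun x => ?_⟩
  have hx := b.sum_repr x
  simp only [Fin.sum_univ_three, b, coe_basisOfLinearIndependentOfCardEqFinrank] at hx
  simp at hx
  have h1 := congrArg a hx
  have h2 := congrArg l hx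
  simp [hlw, haw, hle, hae, hlp, hap] at h1 h2
  rw [← h1, ← h2]
  exact hx.symm

theorem exists_eq_smul {l a : Module.Dual ℝ (Fin 3 → ℝ)} {p q : Fin 3 → ℝ} (hp : p ≠ 0)
    (hl : l ≠ 0) (hlp : l p = 0) (hap : a p = 0) (h : ∃ v, l v = 0 ∧ a v ≠ 0)
    (hlq : l q = 0) (haq : a q = 0) : ∃ c : ℝ, q = c • p := by
  obtain ⟨w, e, s, -, -, -, -, hs⟩ := exists_adapted_coordinates hp hl hlp hap h
  exact ⟨s q, by simpa [hlq, haq] using hs q⟩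

theorem X_eq_of_coordinates {l a s : Module.Dual ℝ (Fin 3 → ℝ)} {p w e : Fin 3 → ℝ}
    (h : ∀ x, x = s x • p + a x • w + l x • e) (i : Fin 3) :
    (X i : MvPolynomial (Fin 3) ℝ) =
      C (p i) * linForm s + C (w i) * linForm a + C (e i) * linForm l := by
  refine MvPolynomial.funext fun x => ?_
  have := congrFun (h x) i
  simp [eval_linForm] at this ⊢
  linarith

/-- Modulo `a` and `l` every vector is a multiple `s • p` of `p`, and `H (s • p) = s ^ n * H p = 0`.
-/
theorem exists_eq_mul_add_mul {l a : Module.Dual ℝ (Fin 3 → ℝ)} {p : Fin 3 → ℝ} (hp : p ≠ 0)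
    (hl : l ≠ 0) (hlp : l p = 0) (hap : a p = 0) (h : ∃ v, l v = 0 ∧ a v ≠ 0)
    {H : MvPolynomial (Fin 3) ℝ} {n : ℕ} (hH : H.IsHomogeneous n) (h0 : eval p H = 0) :
    ∃ A B : MvPolynomial (Fin 3) ℝ, A.IsHomogeneous (n - 1) ∧ H = linForm a * A + linForm l * B := by
  obtain ⟨w, e, s, -, -, -, -, hs⟩ := exists_adapted_coordinates hp hl hlp hap h
  have h1 := aeval_sub_aeval_mem (Ideal.span {linForm a, linForm l}) (f := X)
    (g := fun i => C (p i) * linForm s) (fun i => by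
      rw [X_eq_of_coordinates hs i, Ideal.mem_span_pair]
      exact ⟨C (w i), C (e i), by ring⟩) H
  have h2 : aeval (fun i => C (p i) * linForm s) H = (0 : MvPolynomial (Fin 3) ℝ) := by
    refine MvPolynomial.funext fun x => ?_
    have : eval x (aeval (fun i => C (p i) * linForm s) H) = eval (s x • p) H := by
      rw [eval_aeval]
      simp [eval_linForm, Pi.smul_def, mul_comm]
    rw [this, hH.eval_smul, h0]
    simp
  rw [h2, aeval_X_left_apply, sub_zero, Ideal.mem_span_pair] at h1
  obtain ⟨A, B, hAB⟩ := h1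
  obtain ⟨A', hA', h3⟩ := (isHomogeneous_linForm a).exists_homogeneousComponent_mul n A
  obtain ⟨B', hB', h4⟩ := (isHomogeneous_linForm l).exists_homogeneousComponent_mul n B
  refine ⟨A', B', hA', ?_⟩
  rw [← h3, ← h4, ← map_add, mul_comm _ A, mul_comm _ B, hAB, homogeneousComponent_eq_self hH]

/-- Modulo `l`, a vector may be replaced by its projection along `u` to the kernel of `l`, where `H`
vanishes. -/
theorem linForm_dvd {l : Module.Dual ℝ (Fin 3 → ℝ)} (hl : l ≠ 0) {H : MvPolynomial (Fin 3) ℝ}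
    (h : ∀ v, l v = 0 → eval v H = 0) : linForm l ∣ H := by
  obtain ⟨u, hu⟩ : ∃ u, l u ≠ 0 := by
    by_contra! h; exact hl (LinearMap.ext h)
  have h1 := aeval_sub_aeval_mem (Ideal.span {linForm l}) (f := X)
    (g := fun i => X i - C (u i / l u) * linForm l) (fun i => by
      rw [Ideal.mem_span_singleton]
      exact ⟨C (u i / l u), by ring⟩) H
  have h2 : aeval (fun i => X i - C (u i / l u) * linForm l) H
      = (0 : MvPolynomial (Fin 3) ℝ) := by
    refine MvPolynomial.funext fun x => ?_
    have : eval x (aeval (fun i => X i - C (u i / l u) * linForm l) H)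
        = eval (x - (l x / l u) • u) H := by
      rw [eval_aeval]
      refine congrArg (fun y => eval y H) (funext fun i => ?_)
      simp [eval_linForm]
      ring
    rw [this, h _ (by simp [hu])]
    simp
  rwa [h2, aeval_X_left_apply, sub_zero, Ideal.mem_span_singleton] at h1

/-! ### Differentials, formal arcs and orders of vanishing -/

namespace MvPolynomial

/-- The chain rule, needed both for d/dt on power series and for d/dy on polynomials over them. -/
theorem derivation_aeval {σ R S : Type*} [Fintype σ] [CommRing R] [CommRing S] [Algebra R S]
    (D : Derivation R S S) (f : σ → S) (H : MvPolynomial σ R) :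
    D (aeval f H) = ∑ i, aeval f (pderiv i H) * D (f i) := by
  classical
  induction H using MvPolynomial.induction_on with
  | C a => simp
  | add p q hp hq => simp [hp, hq, add_mul, Finset.sum_add_distrib]
  | mul_X p i hp =>
    simp only [map_mul, aeval_X, Derivation.leibniz, hp, pderiv_X, map_add, add_mul, smul_eq_mul,
      Finset.sum_add_distrib, Finset.mul_sum]
    congr 1
    · simp [Pi.single_apply, apply_ite]
    · refine Finset.sum_congr rfl fun j _ => by ring

/-- The differential of a ternary form at a vector. -/
noncomputable def differential (F : MvPolynomial (Fin 3) ℝ) (p : Fin 3 → ℝ) :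
    Module.Dual ℝ (Fin 3 → ℝ) :=
  ∑ i, eval p (pderiv i F) • (LinearMap.proj i : (Fin 3 → ℝ) →ₗ[ℝ] ℝ)

theorem differential_apply (F : MvPolynomial (Fin 3) ℝ) (p v : Fin 3 → ℝ) :
    differential F p v = ∑ i, eval p (pderiv i F) * v i := by
  simp [differential]

theorem IsHomogeneous.differential_self {F : MvPolynomial (Fin 3) ℝ} {n : ℕ}
    (hF : F.IsHomogeneous n) {p : Fin 3 → ℝ} (h : eval p F = 0) : differential F p p = 0 := by
  have := congrArg (eval p) hF.sum_X_mul_pderiv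
  rw [differential_apply]
  simp [h] at this
  simpa [mul_comm] using this

end MvPolynomial

/-- The formal arc `p + t u + g(t) v`. -/
noncomputable def arc (p u v : Fin 3 → ℝ) (g : PowerSeries ℝ) : Fin 3 → PowerSeries ℝ :=
  fun i => PowerSeries.C (p i) + PowerSeries.C (u i) * PowerSeries.X + PowerSeries.C (v i) * g

/-- The formal arc `p + t w`. -/
noncomputable def lineArc (p w : Fin 3 → ℝ) : Fin 3 → PowerSeries ℝ := arc p w 0 0

theorem lineArc_eq_arc (p w v : Fin 3 → ℝ) : lineArc p w = arc p w v 0 := by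
  funext i; simp [lineArc, arc]

/-- The order of vanishing of a form along a formal arc. -/
noncomputable def ordAlong (γ : Fin 3 → PowerSeries ℝ) (H : MvPolynomial (Fin 3) ℝ) : ℕ∞ :=
  (aeval γ H).order

theorem ordAlong_mul (γ : Fin 3 → PowerSeries ℝ) (H K : MvPolynomial (Fin 3) ℝ) :
    ordAlong γ (H * K) = ordAlong γ H + ordAlong γ K := by
  rw [ordAlong, map_mul, PowerSeries.order_mul]; rfl

theorem constantCoeff_aeval (γ : Fin 3 → PowerSeries ℝ) (H : MvPolynomial (Fin 3) ℝ) :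
    PowerSeries.constantCoeff (aeval γ H) =
      eval (fun i => PowerSeries.constantCoeff (γ i)) H := by
  induction H using MvPolynomial.induction_on with
  | C a => simp
  | add p q hp hq => simp [hp, hq]
  | mul_X p i hp => simp [hp]

theorem one_le_ordAlong {γ : Fin 3 → PowerSeries ℝ} {p : Fin 3 → ℝ}
    (h : ∀ i, PowerSeries.constantCoeff (γ i) = p i) (H : MvPolynomial (Fin 3) ℝ) :
    1 ≤ ordAlong γ H ↔ eval p H = 0 := by
  rw [ordAlong, PowerSeries.one_le_order_iff_constCoeff_eq_zero, constantCoeff_aeval, funext h]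

theorem constantCoeff_arc (p u v : Fin 3 → ℝ) {g : PowerSeries ℝ}
    (hg : PowerSeries.constantCoeff g = 0) (i : Fin 3) :
    PowerSeries.constantCoeff (arc p u v g i) = p i := by
  simp [arc, hg]

theorem aeval_arc_linForm (p u v : Fin 3 → ℝ) (g : PowerSeries ℝ)
    (l : Module.Dual ℝ (Fin 3 → ℝ)) :
    aeval (arc p u v g) (linForm l) =
      PowerSeries.C (l p) + PowerSeries.C (l u) * PowerSeries.X + PowerSeries.C (l v) * g := by
  have e : ∀ x : Fin 3 → ℝ, l x = ∑ i, l (Pi.single i 1) * x i := fun x => by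
    rw [← eval_linForm]; simp [linForm]
  rw [e p, e u, e v]
  simp only [linForm, map_sum, map_mul, aeval_X, aeval_C, PowerSeries.algebraMap_apply, arc,
    Finset.sum_mul, ← Finset.sum_add_distrib]
  refine Finset.sum_congr rfl fun i _ => ?_
  simp
  ring

theorem coeff_one_aeval_lineArc (p w : Fin 3 → ℝ) (H : MvPolynomial (Fin 3) ℝ) :
    PowerSeries.coeff 1 (aeval (lineArc p w) H) = differential H p w := by
  have h := derivation_aeval (PowerSeries.derivative ℝ) (lineArc p w) H
  have h2 := congrArg PowerSeries.constantCoeff h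
  rw [← PowerSeries.coeff_zero_eq_constantCoeff_apply, PowerSeries.coeff_derivative] at h2
  simp only [zero_add, Nat.cast_zero, mul_one, map_sum, map_mul, constantCoeff_aeval] at h2
  rw [h2, differential_apply]
  refine Finset.sum_congr rfl fun i _ => ?_
  congr 1
  · simp [lineArc, arc]
  · simp [lineArc, arc, Derivation.leibniz]

theorem order_eq_one {f : PowerSeries ℝ} (h0 : PowerSeries.constantCoeff f = 0)
    (h1 : PowerSeries.coeff 1 f ≠ 0) : f.order = 1 := by
  refine PowerSeries.order_eq_nat.2 ⟨h1, fun i hi => ?_⟩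
  obtain rfl : i = 0 := by omega
  simpa using h0

/-! ### Formal branches at nonsingular points -/

theorem exists_eval_ne_zero_and_apply_ne_zero {F : MvPolynomial (Fin 3) ℝ} (hF : F ≠ 0)
    {l : Module.Dual ℝ (Fin 3 → ℝ)} (hl : l ≠ 0) : ∃ v, eval v F ≠ 0 ∧ l v ≠ 0 := by
  by_contra! h
  have h0 : F * linForm l = 0 := MvPolynomial.funext fun x => by
    by_cases hx : eval x F = 0
    · simp [hx]
    · simp [eval_linForm, h x hx]
  rcases mul_eq_zero.1 h0 with h1 | h1
  · exact hF h1
  · refine hl (LinearMap.ext fun x => ?_)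
    rw [← eval_linForm, h1]; simp

theorem exists_mem_ker_not_smul {l : Module.Dual ℝ (Fin 3 → ℝ)} (p : Fin 3 → ℝ) :
    ∃ w, l w = 0 ∧ ∀ c : ℝ, w ≠ c • p := by
  by_contra! h
  have h1 : LinearMap.ker l ≤ Submodule.span ℝ {p} := fun w hw => by
    obtain ⟨c, hc⟩ := h w hw
    exact Submodule.mem_span_singleton.2 ⟨c, hc.symm⟩
  have h2 := (Submodule.finrank_mono h1).trans (finrank_span_le_card {p})
  have h3 := LinearMap.finrank_range_add_finrank_ker l
  have h4 := Submodule.finrank_le (LinearMap.range l)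
  simp at h2 h3 h4
  omega

/-- The restriction of a form to the pencil of vectors `a + y v`, as a polynomial in `y`. -/
noncomputable def pencilPoly (a : Fin 3 → PowerSeries ℝ) (v : Fin 3 → ℝ)
    (F : MvPolynomial (Fin 3) ℝ) : Polynomial (PowerSeries ℝ) :=
  aeval (fun i => Polynomial.C (a i) + Polynomial.C (PowerSeries.C (v i)) * Polynomial.X) F

theorem eval_pencilPoly (a : Fin 3 → PowerSeries ℝ) (v : Fin 3 → ℝ)
    (F : MvPolynomial (Fin 3) ℝ) (g : PowerSeries ℝ) :
    (pencilPoly a v F).eval g = aeval (fun i => a i + PowerSeries.C (v i) * g) F := by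
  induction F using MvPolynomial.induction_on with
  | C r => simp [pencilPoly, 
      IsScalarTower.algebraMap_apply ℝ (PowerSeries ℝ) (Polynomial (PowerSeries ℝ))]
  | add p q hp hq => simp [pencilPoly] at hp hq ⊢; simp [hp, hq]
  | mul_X p i hp => simp [pencilPoly] at hp ⊢; simp [hp]

theorem eval_derivative_pencilPoly (a : Fin 3 → PowerSeries ℝ) (v : Fin 3 → ℝ)
    (F : MvPolynomial (Fin 3) ℝ) :
    (pencilPoly a v F).derivative.eval 0 = ∑ i, aeval a (pderiv i F) * PowerSeries.C (v i) := by
  have h := derivation_aeval (Polynomial.derivative'.restrictScalars ℝ)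
    (fun i => Polynomial.C (a i) + Polynomial.C (PowerSeries.C (v i)) * Polynomial.X) F
  have h2 := congrArg (Polynomial.eval 0) h
  refine h2.trans ?_
  rw [Polynomial.eval_finsetSum]
  refine Finset.sum_congr rfl fun i _ => ?_
  rw [Polynomial.eval_mul]
  congr 1
  · have := eval_pencilPoly a v (pderiv i F) 0
    simpa [pencilPoly] using this
  · simp

/-- For `v` off the curve the top coefficient is a unit, so the polynomial can be scaled to a monic
one, as Hensel's lemma requires. -/
theorem coeff_pencilPoly (a : Fin 3 → PowerSeries ℝ) (v : Fin 3 → ℝ)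
    {F : MvPolynomial (Fin 3) ℝ} {n : ℕ} (hF : F.IsHomogeneous n) :
    (pencilPoly a v F).natDegree ≤ n ∧
      (pencilPoly a v F).coeff n = PowerSeries.C (eval v F) := by
  have hlin : ∀ i, (Polynomial.C (a i) + Polynomial.C (PowerSeries.C (v i)) *
      Polynomial.X).natDegree ≤ 1 := fun i => by compute_degree
  have hpow : ∀ (i : Fin 3) (k : ℕ), ((Polynomial.C (a i) + Polynomial.C (PowerSeries.C (v i)) *
      Polynomial.X) ^ k).natDegree ≤ k ∧ ((Polynomial.C (a i) +
      Polynomial.C (PowerSeries.C (v i)) * Polynomial.X) ^ k).coeff k =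
      PowerSeries.C (v i ^ k) := fun i k => by
    constructor
    · simpa using Polynomial.natDegree_pow_le_of_le k (hlin i)
    · have := Polynomial.coeff_pow_of_natDegree_le (m := k) (hlin i)
      rw [mul_one] at this
      rw [this]
      simp [Polynomial.coeff_C]
  have hsum : ∀ d ∈ F.support, n = d 0 + d 1 + d 2 := fun d hd => by
    rw [hF.degree_eq_sum_deg_support hd, ← Fin.sum_univ_three]
    exact Finset.sum_subset (Finset.subset_univ _) (by simp)
  have hexp : pencilPoly a v F = ∑ d ∈ F.support, Polynomial.C (PowerSeries.C (coeff d F)) *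
      ((Polynomial.C (a 0) + Polynomial.C (PowerSeries.C (v 0)) * Polynomial.X) ^ d 0 *
      (Polynomial.C (a 1) + Polynomial.C (PowerSeries.C (v 1)) * Polynomial.X) ^ d 1 *
      (Polynomial.C (a 2) + Polynomial.C (PowerSeries.C (v 2)) * Polynomial.X) ^ d 2) := by
    rw [pencilPoly, aeval_def, eval₂_eq']
    refine Finset.sum_congr rfl fun d _ => ?_
    rw [Fin.prod_univ_three]
    rfl
  rw [hexp]
  constructor
  · refine Polynomial.natDegree_sum_le_of_forall_le _ _ fun d hd => ?_
    refine (Polynomial.natDegree_C_mul_le _ _).trans ?_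
    rw [hsum d hd]
    exact Polynomial.natDegree_mul_le_of_le
      (Polynomial.natDegree_mul_le_of_le (hpow 0 _).1 (hpow 1 _).1) (hpow 2 _).1
  · rw [eval_eq', Polynomial.finsetSum_coeff, map_sum]
    refine Finset.sum_congr rfl fun d hd => ?_
    rw [Polynomial.coeff_C_mul, Fin.prod_univ_three, hsum d hd,
      Polynomial.coeff_mul_add_eq_of_natDegree_le
        (Polynomial.natDegree_mul_le_of_le (hpow 0 _).1 (hpow 1 _).1) (hpow 2 _).1,
      Polynomial.coeff_mul_add_eq_of_natDegree_le (hpow 0 _).1 (hpow 1 _).1, (hpow 0 _).2,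
      (hpow 1 _).2, (hpow 2 _).2]
    simp only [map_mul]

/-- Hensel's lemma for y ↦ F(p + tu + yv): y = 0 is a root modulo t, and a simple one because the
derivative there is the differential at `p` applied to `v`. -/
theorem exists_branch_solution {F : MvPolynomial (Fin 3) ℝ} {n : ℕ} (hF : F.IsHomogeneous n)
    {p v : Fin 3 → ℝ} (u : Fin 3 → ℝ) (h0 : eval p F = 0) (hv : eval v F ≠ 0)
    (hd : differential F p v ≠ 0) :
    ∃ g : PowerSeries ℝ, PowerSeries.constantCoeff g = 0 ∧ aeval (arc p u v g) F = 0 ∧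
      ∃ c : PowerSeries ℝ, IsUnit c ∧ aeval (lineArc p u) F = g * c := by
  set f := pencilPoly (lineArc p u) v F with hf
  have hev : ∀ g, f.eval g = aeval (arc p u v g) F := fun g => by
    rw [hf, eval_pencilPoly]
    congr 2
    funext i; simp [lineArc, arc]
  obtain ⟨hdeg, hco⟩ := coeff_pencilPoly (lineArc p u) v hF
  have hf0 : PowerSeries.constantCoeff (f.eval 0) = 0 := by
    rw [hev, constantCoeff_aeval]
    simpa [arc] using h0
  have hf1 : PowerSeries.constantCoeff (f.derivative.eval 0) = differential F p v := by
    rw [hf, eval_derivative_pencilPoly, differential_apply, map_sum]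
    refine Finset.sum_congr rfl fun i _ => ?_
    rw [map_mul, constantCoeff_aeval]
    simp [lineArc, arc]
  have hunit : IsUnit (f.derivative.eval 0) := by
    rw [PowerSeries.isUnit_iff_constantCoeff, hf1]
    exact hd.isUnit
  set r : PowerSeries ℝ := PowerSeries.C (eval v F)⁻¹ with hr
  have hru : IsUnit r := by
    rw [PowerSeries.isUnit_iff_constantCoeff]; simpa [hr] using hv
  have hmonic : (Polynomial.C r * f).Monic := by
    refine Polynomial.monic_of_natDegree_le_of_coeff_eq_one n
      ((Polynomial.natDegree_C_mul_le _ _).trans hdeg) ?_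
    rw [Polynomial.coeff_C_mul, hco, hr, ← map_mul, inv_mul_cancel₀ hv, map_one]
  obtain ⟨g, hg, hg0⟩ := HenselianRing.is_henselian (I := Ideal.span {PowerSeries.X})
    (Polynomial.C r * f) hmonic 0
    (by
      rw [Polynomial.eval_C_mul, Ideal.mem_span_singleton, PowerSeries.X_dvd_iff, map_mul, hf0,
        mul_zero])
    (by
      refine IsUnit.map _ ?_
      rw [Polynomial.derivative_C_mul, Polynomial.eval_C_mul]
      exact hru.mul hunit)
  rw [sub_zero, Ideal.mem_span_singleton, PowerSeries.X_dvd_iff] at hg0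
  rw [Polynomial.IsRoot, Polynomial.eval_C_mul, hru.mul_right_eq_zero] at hg
  -- Taylor expansion: 0 = f(g) = f(0) + f'(0) g + k g², so F(p + tu) = f(0) is `g` times a unit.
  obtain ⟨k, hk⟩ := f.binomExpansion 0 g
  rw [zero_add, hg] at hk
  refine ⟨g, hg0, by rw [← hev, hg], -(f.derivative.eval 0 + k * g), ?_, ?_⟩
  · rw [PowerSeries.isUnit_iff_constantCoeff]
    simpa [hg0, hf1] using hd
  · rw [lineArc_eq_arc p u v, ← hev]
    linear_combination -hk

theorem exists_dual_eq_zero_ne_zero {p w : Fin 3 → ℝ} (h : ∀ c : ℝ, w ≠ c • p) :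
    ∃ a : Module.Dual ℝ (Fin 3 → ℝ), a p = 0 ∧ a w ≠ 0 := by
  obtain ⟨a, ha, ha'⟩ := Submodule.exists_le_ker_of_notMem (p := Submodule.span ℝ {p}) (v := w)
    (fun hw => by
      obtain ⟨c, hc⟩ := Submodule.mem_span_singleton.1 hw
      exact h c hc.symm)
  exact ⟨a, ha' (Submodule.mem_span_singleton_self p), ha⟩

theorem exists_eq_smul_of_ker_le {l d : Module.Dual ℝ (Fin 3 → ℝ)}
    (h : ∀ v, l v = 0 → d v = 0) : ∃ c : ℝ, d = c • l := by
  by_cases hl : l = 0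
  · exact ⟨0, LinearMap.ext fun x => by simpa using h x (by simp [hl])⟩
  obtain ⟨u, hu⟩ : ∃ u, l u ≠ 0 := by
    by_contra! h; exact hl (LinearMap.ext h)
  refine ⟨d u / l u, LinearMap.ext fun x => ?_⟩
  have := h (x - (l x / l u) • u) (by simp [hu])
  simp at this ⊢
  rw [sub_eq_zero.1 this]
  ring

theorem linForm_smul (c : ℝ) (l : Module.Dual ℝ (Fin 3 → ℝ)) :
    linForm (c • l) = C c * linForm l :=
  MvPolynomial.funext fun x => by simp [eval_linForm]

theorem ordAlong_linForm_smul (γ : Fin 3 → PowerSeries ℝ) {c : ℝ} (hc : c ≠ 0)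
    (l : Module.Dual ℝ (Fin 3 → ℝ)) : ordAlong γ (linForm (c • l)) = ordAlong γ (linForm l) := by
  rw [linForm_smul, ordAlong_mul, ordAlong, aeval_C, PowerSeries.order_zero_of_unit, zero_add]
  exact (IsUnit.mk0 c hc).map _

/-- A formal branch `γ` of the curve `F = 0` at the point `p`, which has the same contact with the
curve's lines through `p` as the curve itself. -/
structure IsBranch (F : MvPolynomial (Fin 3) ℝ) (p : Fin 3 → ℝ) (γ : Fin 3 → PowerSeries ℝ) :
    Prop where
  constantCoeff_eq : ∀ i, PowerSeries.constantCoeff (γ i) = p i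
  aeval_eq_zero : aeval γ F = 0
  exists_lineArc : ∀ l : Module.Dual ℝ (Fin 3 → ℝ), l ≠ 0 → l p = 0 →
    ∃ w, l w = 0 ∧ (∀ c : ℝ, w ≠ c • p) ∧
      ordAlong (lineArc p w) F = ordAlong γ (linForm l) ∧
      ∀ H, ordAlong γ (linForm l) ≤ ordAlong γ H →
        ordAlong γ (linForm l) ≤ ordAlong (lineArc p w) H

theorem constantCoeff_lineArc (p w : Fin 3 → ℝ) (i : Fin 3) :
    PowerSeries.constantCoeff (lineArc p w i) = p i := by
  simp [lineArc, arc]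

/-- Let `u` be a tangent direction and γ = p + tu + gv. For the tangent line, l(γ) = l(v) g has the
order of F(p + tu), and H(p + tu) ≡ H(γ) modulo `g`. For any other line both orders are 1, and the
last clause only concerns the value of `H` at `p`. -/
theorem exists_isBranch {F : MvPolynomial (Fin 3) ℝ} {n : ℕ} (hF : F.IsHomogeneous n)
    {p : Fin 3 → ℝ} (hp : p ≠ 0) (h0 : eval p F = 0) (hd : differential F p ≠ 0) :
    ∃ γ, IsBranch F p γ := by
  have hF0 : F ≠ 0 := by
    rintro rfl
    exact hd (LinearMap.ext fun v => by simp [differential_apply])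
  obtain ⟨v, hv, hdv⟩ := exists_eval_ne_zero_and_apply_ne_zero hF0 hd
  obtain ⟨u, hdu, hu⟩ := exists_mem_ker_not_smul (l := differential F p) p
  have hdp : differential F p p = 0 := hF.differential_self h0
  obtain ⟨g, hg0, hgF, c, hc, hgc⟩ := exists_branch_solution hF u h0 hv hdv
  have hconst : ∀ i, PowerSeries.constantCoeff (arc p u v g i) = p i := constantCoeff_arc p u v hg0
  refine ⟨arc p u v g, hconst, hgF, fun l hl hlp => ?_⟩
  have hordg : ordAlong (lineArc p u) F = g.order := by
    rw [ordAlong, hgc, PowerSeries.order_mul, PowerSeries.order_zero_of_unit hc, add_zero]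
  by_cases hlu : l u = 0
  -- The kernel of the differential is spanned by `p` and `u` and misses `v`, so a functional
  -- killing all three is zero.
  · have hlv : l v ≠ 0 := by
      intro hlv
      refine hl (LinearMap.ext fun x => ?_)
      obtain ⟨a, hap, hau⟩ := exists_dual_eq_zero_ne_zero hu
      set y := x - (differential F p x / differential F p v) • v with hy
      have hdy : differential F p y = 0 := by simp [hy, hdv]
      obtain ⟨k, hk⟩ := exists_eq_smul (q := y - (a y / a u) • u) hp hd hdp hap ⟨u, hdu, hau⟩
        (by simp [hdy, hdu]) (by simp [hau])
      have h1 := congrArg l hk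
      simpa [hlp, hlu, hy, hlv] using h1
    have hord : ordAlong (arc p u v g) (linForm l) = g.order := by
      rw [ordAlong, aeval_arc_linForm, hlp, hlu, map_zero, zero_mul, zero_add, zero_add,
        PowerSeries.order_mul, PowerSeries.order_zero_of_unit ((IsUnit.mk0 _ hlv).map _), zero_add]
    refine ⟨u, hlu, hu, by rw [hordg, hord], fun H hH => ?_⟩
    rw [hord] at hH ⊢
    have hmem := aeval_sub_aeval_mem (Ideal.span {g}) (f := lineArc p u) (g := arc p u v g)
      (fun i => by
        rw [Ideal.mem_span_singleton]
        exact ⟨-PowerSeries.C (v i), by simp [lineArc, arc]; ring⟩) H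
    obtain ⟨k, hk⟩ := Ideal.mem_span_singleton.1 hmem
    rw [ordAlong, sub_eq_iff_eq_add.1 hk]
    refine le_trans (le_min ?_ hH) (PowerSeries.min_order_le_order_add _ _)
    rw [PowerSeries.order_mul]
    exact le_self_add
  · obtain ⟨w, hlw, hw⟩ := exists_mem_ker_not_smul (l := l) p
    have hdw : differential F p w ≠ 0 := by
      intro hdw
      obtain ⟨k, hk⟩ := exists_eq_smul hp hd hdp hlp ⟨u, hdu, hlu⟩ hdw hlw
      exact hw k hk
    -- `g` times a unit is F(p + tu), which has no linear term because `u` is tangent.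
    have hg1 : PowerSeries.coeff 1 g = 0 := by
      have h1 := coeff_one_aeval_lineArc p u F
      rw [hgc, hdu, PowerSeries.coeff_mul] at h1
      simp [Finset.Nat.antidiagonal_succ, hg0] at h1
      exact h1.resolve_right fun h => by
        rw [PowerSeries.isUnit_iff_constantCoeff, h] at hc
        simp at hc
    have hord : ordAlong (arc p u v g) (linForm l) = 1 := by
      rw [ordAlong, aeval_arc_linForm]
      refine order_eq_one (by simp [hlp, hg0]) ?_
      simp [hlp, hg1, hlu, PowerSeries.coeff_C]
    refine ⟨w, hlw, hw, ?_, fun H hH => ?_⟩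
    · rw [hord, ordAlong]
      refine order_eq_one ?_ (by rwa [coeff_one_aeval_lineArc])
      rw [constantCoeff_aeval, funext (constantCoeff_lineArc p w), h0]
    · rw [hord] at hH ⊢
      rw [one_le_ordAlong hconst] at hH
      rwa [one_le_ordAlong (constantCoeff_lineArc p w)]

/-! ### Orders of vanishing along a line -/

theorem aeval_lineArc_linForm (p w : Fin 3 → ℝ) (l : Module.Dual ℝ (Fin 3 → ℝ)) :
    aeval (lineArc p w) (linForm l) =
      PowerSeries.C (l p) + PowerSeries.C (l w) * PowerSeries.X := by
  rw [lineArc, aeval_arc_linForm]; simp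

theorem RealPlane.eq_of_rep_eq_smul {P Q : RealPlane} {c : ℝ} (h : Q.rep = c • P.rep) : Q = P := by
  rw [← P.mk_rep, ← Q.mk_rep, Projectivization.mk_eq_mk_iff']
  exact ⟨c, h.symm⟩

theorem RealPlane.eq_of_dual {l a : Module.Dual ℝ (Fin 3 → ℝ)} {P T : RealPlane} (hl : l ≠ 0)
    (h : ∃ v, l v = 0 ∧ a v ≠ 0) (hlP : l P.rep = 0) (haP : a P.rep = 0)
    (hlT : l T.rep = 0) (haT : a T.rep = 0) : T = P := by
  obtain ⟨c, hc⟩ := exists_eq_smul P.rep_nonzero hl hlP haP h hlT haT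
  exact eq_of_rep_eq_smul hc

open Classical in
/-- The multiplicity of a point `T` in the divisor `P`. -/
noncomputable def pointMult (P T : RealPlane) : ℕ := if T = P then 1 else 0

theorem ordAlong_lineArc_linForm {l a : Module.Dual ℝ (Fin 3 → ℝ)} {P T : RealPlane} (hl : l ≠ 0)
    (h : ∃ v, l v = 0 ∧ a v ≠ 0) (hlP : l P.rep = 0) (haP : a P.rep = 0)
    (hlT : l T.rep = 0) {w : Fin 3 → ℝ} (hlw : l w = 0) (hw : ∀ c : ℝ, w ≠ c • T.rep) :
    ordAlong (lineArc T.rep w) (linForm a) = pointMult P T := by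
  by_cases haT : a T.rep = 0
  · obtain rfl := RealPlane.eq_of_dual hl h hlP haP hlT haT
    have haw : a w ≠ 0 := fun haw => by
      obtain ⟨c, hc⟩ := exists_eq_smul T.rep_nonzero hl hlP haP h hlw haw
      exact hw c hc
    rw [ordAlong, aeval_lineArc_linForm, haT]
    simp only [pointMult, if_true, Nat.cast_one]
    exact order_eq_one (by simp) (by simpa [PowerSeries.coeff_C] using haw)
  · have hTP : T ≠ P := fun h => haT (h ▸ haP)
    rw [pointMult, if_neg hTP, ordAlong, aeval_lineArc_linForm, PowerSeries.order_zero_of_unit]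
    · simp
    · rw [PowerSeries.isUnit_iff_constantCoeff]
      simpa using haT

theorem ordAlong_lineArc_add_mul {l : Module.Dual ℝ (Fin 3 → ℝ)} {p w : Fin 3 → ℝ} (hp : l p = 0)
    (hw : l w = 0) (G B : MvPolynomial (Fin 3) ℝ) :
    ordAlong (lineArc p w) (G + linForm l * B) = ordAlong (lineArc p w) G := by
  simp [ordAlong, aeval_lineArc_linForm, hp, hw]

theorem eval_rep_eq_zero_of_le {P : RealPlane}
    {H : MvPolynomial (Fin 3) ℝ} {w : Fin 3 → ℝ} {k : ℕ} (hk : 1 ≤ k)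
    (h : (k : ℕ∞) ≤ ordAlong (lineArc P.rep w) H) : eval P.rep H = 0 :=
  (one_le_ordAlong (constantCoeff_lineArc P.rep w) H).1 (le_trans (by exact_mod_cast hk) h)

/-! ### Line sections of the cubic and division by a line -/

namespace PlaneCubic

/-- The line `l = 0` meets the cubic in the points `P`, `Q`, `R`, counted with multiplicity. -/
structure IsSection (Γ : PlaneCubic) (l : Module.Dual ℝ (Fin 3 → ℝ)) (P Q R : RealPlane) :
    Prop where
  ne_zero : l ≠ 0
  apply_fst : l P.rep = 0
  apply_snd : l Q.rep = 0
  apply_thd : l R.rep = 0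
  exists_eval_ne_zero : ∃ v, l v = 0 ∧ eval v Γ.form ≠ 0
  exists_factors : ∃ a b c : Module.Dual ℝ (Fin 3 → ℝ), a P.rep = 0 ∧ b Q.rep = 0 ∧ c R.rep = 0 ∧
    ∀ v, l v = 0 → eval v Γ.form = a v * b v * c v

variable {Γ : PlaneCubic} {l : Module.Dual ℝ (Fin 3 → ℝ)} {P Q R : RealPlane}

theorem IsSection.swap (h : Γ.IsSection l P Q R) : Γ.IsSection l Q P R := by
  obtain ⟨h0, h1, h2, h3, h4, a, b, c, ha, hb, hc, hF⟩ := h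
  exact ⟨h0, h2, h1, h3, h4, b, a, c, hb, ha, hc, fun v hv => by rw [hF v hv]; ring⟩

theorem IsSection.rotate (h : Γ.IsSection l P Q R) : Γ.IsSection l Q R P := by
  obtain ⟨h0, h1, h2, h3, h4, a, b, c, ha, hb, hc, hF⟩ := h
  exact ⟨h0, h2, h3, h1, h4, b, c, a, hb, hc, ha, fun v hv => by rw [hF v hv]; ring⟩

theorem IsSection.exists_form_eq (h : Γ.IsSection l P Q R) :
    ∃ (a b c : Module.Dual ℝ (Fin 3 → ℝ)) (K : MvPolynomial (Fin 3) ℝ),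
      a P.rep = 0 ∧ b Q.rep = 0 ∧ c R.rep = 0 ∧ (∃ v, l v = 0 ∧ a v ≠ 0) ∧
      (∃ v, l v = 0 ∧ b v ≠ 0) ∧ (∃ v, l v = 0 ∧ c v ≠ 0) ∧
      Γ.form = linForm a * linForm b * linForm c + linForm l * K := by
  obtain ⟨h0, h1, h2, h3, ⟨v, hv, hv'⟩, a, b, c, ha, hb, hc, hF⟩ := h
  obtain ⟨K, hK⟩ := linForm_dvd (l := l) h0
    (H := Γ.form - linForm a * linForm b * linForm c) (fun v hv => by
      simp [eval_linForm, hF v hv])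
  rw [hF v hv] at hv'
  exact ⟨a, b, c, K, ha, hb, hc, ⟨v, hv, left_ne_zero_of_mul (left_ne_zero_of_mul hv')⟩,
    ⟨v, hv, right_ne_zero_of_mul (left_ne_zero_of_mul hv')⟩, ⟨v, hv, right_ne_zero_of_mul hv'⟩,
    by rw [← hK]; ring⟩

theorem IsSection.ordAlong_lineArc_form (h : Γ.IsSection l P Q R) {T : RealPlane}
    {w : Fin 3 → ℝ} (hT : l T.rep = 0) (hlw : l w = 0) (hw : ∀ c : ℝ, w ≠ c • T.rep) :
    ordAlong (lineArc T.rep w) Γ.form = (pointMult P T + pointMult Q T + pointMult R T : ℕ) := by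
  obtain ⟨a, b, c, K, ha, hb, hc, ha', hb', hc', hF⟩ := h.exists_form_eq
  rw [hF, ordAlong_lineArc_add_mul hT hlw, ordAlong_mul, ordAlong_mul,
    ordAlong_lineArc_linForm h.ne_zero ha' h.apply_fst ha hT hlw hw,
    ordAlong_lineArc_linForm h.ne_zero hb' h.apply_snd hb hT hlw hw,
    ordAlong_lineArc_linForm h.ne_zero hc' h.apply_thd hc hT hlw hw]
  push_cast
  rfl

theorem differential_form_eq_gradient (P : RealPlane) :
    differential Γ.form P.rep = ∑ i, Γ.gradient P i • LinearMap.proj i := rfl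

theorem differential_ne_zero (hP : P ∈ Γ.regularPoints) : differential Γ.form P.rep ≠ 0 := by
  intro h
  refine hP.2 (funext fun i => ?_)
  have := congrArg (fun d => d (Pi.single i 1)) h
  simpa [differential_apply, gradient, Pi.single_apply] using this

theorem exists_branch (hP : P ∈ Γ.regularPoints) : ∃ γ, IsBranch Γ.form P.rep γ :=
  exists_isBranch Γ.homogeneous P.rep_nonzero hP.1 (differential_ne_zero hP)

theorem pointMult_eq_zero_of_apply_ne_zero {T : RealPlane} (hP : l P.rep = 0) (hT : l T.rep ≠ 0) :
    pointMult P T = 0 := by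
  rw [pointMult, if_neg]
  rintro rfl
  exact hT hP

/-- The contact of line and branch equals the order of the cubic form along the line, where that
form is a product of three linear forms. Off the line both sides are 0. -/
theorem IsSection.ordAlong_branch (h : Γ.IsSection l P Q R) {T : RealPlane}
    {γ : Fin 3 → PowerSeries ℝ} (hγ : IsBranch Γ.form T.rep γ) :
    ordAlong γ (linForm l) = (pointMult P T + pointMult Q T + pointMult R T : ℕ) := by
  by_cases hT : l T.rep = 0
  · obtain ⟨w, hlw, hw, h1, -⟩ := hγ.exists_lineArc l h.ne_zero hT
    rw [← h1, h.ordAlong_lineArc_form hT hlw hw]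
  · rw [pointMult_eq_zero_of_apply_ne_zero h.apply_fst hT,
      pointMult_eq_zero_of_apply_ne_zero h.apply_snd hT,
      pointMult_eq_zero_of_apply_ne_zero h.apply_thd hT]
    by_contra hne
    have := Order.one_le_iff_pos.2 (pos_iff_ne_zero.2 hne)
    rw [one_le_ordAlong hγ.constantCoeff_eq, eval_linForm] at this
    exact hT this

/-- A form whose divisor on the cubic contains the section by a line is, modulo the cubic,
divisible by the equation of that line (a special case of Max Noether's theorem). -/
theorem IsSection.exists_eq_mul_add_mul (h : Γ.IsSection l P Q R) (hP : P ∈ Γ.regularPoints)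
    (hQ : Q ∈ Γ.regularPoints) (hR : R ∈ Γ.regularPoints) {γ : RealPlane → Fin 3 → PowerSeries ℝ}
    (hγ : ∀ T ∈ Γ.regularPoints, IsBranch Γ.form T.rep (γ T)) {H : MvPolynomial (Fin 3) ℝ} {n : ℕ}
    (hH : H.IsHomogeneous n)
    (hord : ∀ T ∈ Γ.regularPoints,
      ((pointMult P T + pointMult Q T + pointMult R T : ℕ) : ℕ∞) ≤ ordAlong (γ T) H) :
    ∃ H' K : MvPolynomial (Fin 3) ℝ, H'.IsHomogeneous (n - 1) ∧
      H = linForm l * H' + Γ.form * K := by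
  obtain ⟨a, b, c, K, ha, hb, hc, ha', hb', hc', hF⟩ := h.exists_form_eq
  have key : ∀ T ∈ Γ.regularPoints, l T.rep = 0 → ∃ w, l w = 0 ∧ (∀ c : ℝ, w ≠ c • T.rep) ∧
      ((pointMult P T + pointMult Q T + pointMult R T : ℕ) : ℕ∞) ≤
        ordAlong (lineArc T.rep w) H := fun T hT hlT => by
    obtain ⟨w, hlw, hw, -, h2⟩ := (hγ T hT).exists_lineArc l h.ne_zero hlT
    rw [h.ordAlong_branch (hγ T hT)] at h2
    exact ⟨w, hlw, hw, h2 H (hord T hT)⟩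
  have hself : ∀ T, pointMult T T = 1 := fun T => if_pos rfl
  -- The factors `a`, `b`, `c` are stripped off in turn. Each uses up exactly the multiplicity of
  -- its own point along the line, so the cofactor still vanishes at the next point, even if points
  -- coincide.
  obtain ⟨wP, -, -, h1⟩ := key P hP h.apply_fst
  have hHP : eval P.rep H = 0 := eval_rep_eq_zero_of_le (by rw [hself]; omega) h1
  obtain ⟨A, A', hA, hAH⟩ := _root_.exists_eq_mul_add_mul P.rep_nonzero h.ne_zero h.apply_fst ha
    ha' hH hHP
  obtain ⟨wQ, hlQ, hwQ, h2⟩ := key Q hQ h.apply_snd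
  have hAQ : eval Q.rep A = 0 := by
    rw [hAH, ordAlong_lineArc_add_mul h.apply_snd hlQ, ordAlong_mul,
      ordAlong_lineArc_linForm h.ne_zero ha' h.apply_fst ha h.apply_snd hlQ hwQ, add_assoc,
      Nat.cast_add, ENat.add_le_add_iff_left (ENat.natCast_ne_top _), hself] at h2
    exact eval_rep_eq_zero_of_le (by omega) h2
  obtain ⟨B, B', hB, hBA⟩ := _root_.exists_eq_mul_add_mul Q.rep_nonzero h.ne_zero h.apply_snd hb
    hb' hA hAQ
  obtain ⟨wR, hlR, hwR, h3⟩ := key R hR h.apply_thd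
  have hBR : eval R.rep B = 0 := by
    rw [hAH, ordAlong_lineArc_add_mul h.apply_thd hlR, ordAlong_mul,
      ordAlong_lineArc_linForm h.ne_zero ha' h.apply_fst ha h.apply_thd hlR hwR, hBA,
      ordAlong_lineArc_add_mul h.apply_thd hlR, ordAlong_mul,
      ordAlong_lineArc_linForm h.ne_zero hb' h.apply_snd hb h.apply_thd hlR hwR, add_assoc,
      Nat.cast_add, ENat.add_le_add_iff_left (ENat.natCast_ne_top _),
      Nat.cast_add, ENat.add_le_add_iff_left (ENat.natCast_ne_top _), hself] at h3
    exact eval_rep_eq_zero_of_le le_rfl h3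
  obtain ⟨D, D', -, hDB⟩ := _root_.exists_eq_mul_add_mul R.rep_nonzero h.ne_zero h.apply_thd hc
    hc' hB hBR
  -- Modulo `l`, `H` is `a * b * c * D`, and `a * b * c` is the cubic form minus `l * K`.
  have hsum : H = linForm l * (A' + linForm a * B' + linForm a * linForm b * D' - K * D) +
      Γ.form * D := by
    rw [hF, hAH, hBA, hDB]; ring
  obtain ⟨E, hE, hE'⟩ := (isHomogeneous_linForm l).exists_homogeneousComponent_mul n
    (A' + linForm a * B' + linForm a * linForm b * D' - K * D)
  obtain ⟨D₁, -, hD₁⟩ := Γ.homogeneous.exists_homogeneousComponent_mul n D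
  refine ⟨E, D₁, hE, ?_⟩
  rw [← hE', ← hD₁, ← map_add, ← hsum, homogeneousComponent_eq_self hH]

/-- The cubic form vanishes along each branch, so `H` and `l * H'` have the same order there, and
the finite order of `l` cancels. -/
theorem IsSection.exists_quotient (h : Γ.IsSection l P Q R) (hP : P ∈ Γ.regularPoints)
    (hQ : Q ∈ Γ.regularPoints) (hR : R ∈ Γ.regularPoints) {γ : RealPlane → Fin 3 → PowerSeries ℝ}
    (hγ : ∀ T ∈ Γ.regularPoints, IsBranch Γ.form T.rep (γ T)) {H : MvPolynomial (Fin 3) ℝ} {n : ℕ}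
    (hH : H.IsHomogeneous n) {m : RealPlane → ℕ}
    (hord : ∀ T ∈ Γ.regularPoints, ordAlong (γ T) H =
      ((pointMult P T + pointMult Q T + pointMult R T + m T : ℕ) : ℕ∞)) :
    ∃ H' : MvPolynomial (Fin 3) ℝ, H'.IsHomogeneous (n - 1) ∧
      ∀ T ∈ Γ.regularPoints, ordAlong (γ T) H' = m T := by
  obtain ⟨H', K, hH', hK⟩ := h.exists_eq_mul_add_mul hP hQ hR hγ hH (fun T hT => by
    rw [hord T hT]; exact_mod_cast Nat.le_add_right _ _)
  refine ⟨H', hH', fun T hT => ?_⟩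
  have h1 := hord T hT
  have h2 : ordAlong (γ T) H = ordAlong (γ T) (linForm l * H') := by
    rw [hK, ordAlong, map_add, map_mul _ Γ.form, (hγ T hT).aeval_eq_zero, zero_mul, add_zero,
      ordAlong]
  rw [h2, ordAlong_mul, h.ordAlong_branch (hγ T hT), Nat.cast_add _ (m T)] at h1
  exact ENat.add_right_injective_of_ne_top (ENat.natCast_ne_top _) h1

/-- A line meeting the curve twice at `P` lies in the kernel of the differential at `P`. -/
theorem IsSection.differential_apply_eq_zero (h : Γ.IsSection l P P R) {v : Fin 3 → ℝ}
    (hv : l v = 0) : differential Γ.form P.rep v = 0 := by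
  obtain ⟨a, b, c, K, ha, hb, hc, -, -, -, hF⟩ := h.exists_form_eq
  rw [← coeff_one_aeval_lineArc, hF, map_add, map_mul, map_mul, map_mul]
  simp only [aeval_lineArc_linForm, ha, hb, hv, h.apply_fst]
  have e : (PowerSeries.C (0 : ℝ) + PowerSeries.C (a v) * PowerSeries.X) *
      (PowerSeries.C 0 + PowerSeries.C (b v) * PowerSeries.X) *
      (PowerSeries.C (c P.rep) + PowerSeries.C (c v) * PowerSeries.X) +
      (PowerSeries.C 0 + PowerSeries.C 0 * PowerSeries.X) * aeval (lineArc P.rep v) K =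
      PowerSeries.X ^ 2 * (PowerSeries.C (a v) * PowerSeries.C (b v) *
      (PowerSeries.C (c P.rep) + PowerSeries.C (c v) * PowerSeries.X)) := by
    simp only [map_zero]; ring
  rw [e, PowerSeries.coeff_X_pow_mul']
  simp

/-- If `R` is neither `P` nor `Q`, the line meets the cubic at `R` with multiplicity one; a zero
gradient would make it at least two. -/
theorem IsSection.regular_thd (h : Γ.IsSection l P Q R) (hP : P ∈ Γ.regularPoints)
    (hQ : Q ∈ Γ.regularPoints) : R ∈ Γ.regularPoints := by
  by_cases h1 : R = P
  · exact h1 ▸ hP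
  by_cases h2 : R = Q
  · exact h2 ▸ hQ
  refine ⟨?_, fun hgrad => ?_⟩
  · obtain ⟨a, b, c, -, -, hc, hF⟩ := h.exists_factors
    exact (hF _ h.apply_thd).trans (by rw [hc, mul_zero])
  · obtain ⟨w, hlw, hw⟩ := exists_mem_ker_not_smul (l := l) R.rep
    have h3 := h.ordAlong_lineArc_form h.apply_thd hlw hw
    simp only [pointMult, if_neg h1, if_neg h2, if_true] at h3
    have h4 := PowerSeries.order_eq_nat.1 h3
    refine h4.1 ?_
    rw [coeff_one_aeval_lineArc, differential_form_eq_gradient, hgrad]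
    simp

/-- Otherwise `l` divides the cubic form with a quadratic cofactor. Forms of positive degree vanish
at 0, so neither factor is a unit. -/
theorem exists_eval_form_ne_zero (hl : l ≠ 0) : ∃ v, l v = 0 ∧ eval v Γ.form ≠ 0 := by
  by_contra! h
  obtain ⟨K, hK⟩ := linForm_dvd hl h
  have hnu : ∀ {G : MvPolynomial (Fin 3) ℝ} {n : ℕ}, G.IsHomogeneous (n + 1) → ¬ IsUnit G := by
    intro G n hG hu
    have h0 := hG.eval_smul 0 0
    rw [smul_zero, zero_pow n.succ_ne_zero, zero_mul] at h0
    exact (hu.map (eval (0 : Fin 3 → ℝ))).ne_zero h0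
  rcases Γ.irreducible.isUnit_or_isUnit hK with hu | hu
  · exact hnu (n := 0) (isHomogeneous_linForm l) hu
  · obtain ⟨K', hK', hK''⟩ := (isHomogeneous_linForm l).exists_homogeneousComponent_mul 3 K
    rw [← hK, homogeneousComponent_eq_self Γ.homogeneous] at hK''
    have hne : linForm l ≠ 0 := fun h0 => Γ.irreducible.ne_zero (by rw [hK, h0, zero_mul])
    have : K = K' := mul_left_cancel₀ hne (hK.symm.trans hK'')
    exact hnu (n := 1) hK' (this ▸ hu)

theorem exists_dual_line (hP : P ∈ Γ.regularPoints) :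
    ∃ l : Module.Dual ℝ (Fin 3 → ℝ), l ≠ 0 ∧ l P.rep = 0 ∧ l Q.rep = 0 ∧
      (P = Q → l = differential Γ.form P.rep) := by
  by_cases h : P = Q
  · subst h
    have := Γ.homogeneous.differential_self hP.1
    exact ⟨_, differential_ne_zero hP, this, this, fun _ => rfl⟩
  · have hlt : Submodule.span ℝ {P.rep, Q.rep} < ⊤ := by
      refine lt_top_iff_ne_top.2 fun htop => ?_
      have h1 := finrank_span_le_card (R := ℝ) ({P.rep, Q.rep} : Set (Fin 3 → ℝ))
      rw [htop] at h1
      have h2 := Finset.card_le_two (a := P.rep) (b := Q.rep)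
      simp at h1
      omega
    obtain ⟨l, hl, hle⟩ := Submodule.exists_le_ker_of_lt_top _ hlt
    exact ⟨l, hl, hle (Submodule.subset_span (by simp)), hle (Submodule.subset_span (by simp)),
      fun h' => absurd h' h⟩

/-- Restricted to the line, the form is divisible by linear forms vanishing at `P` and `Q`. The
remaining factor is linear, so by dimension it has a zero on the line. -/
theorem exists_isSection (hP : P ∈ Γ.regularPoints) (hQ : Q ∈ Γ.regularPoints) :
    ∃ l R, Γ.IsSection l P Q R := by
  obtain ⟨l, hl, hlP, hlQ, htan⟩ := exists_dual_line (Q := Q) hP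
  obtain ⟨v₀, hv₀, hv₀'⟩ := exists_eval_form_ne_zero (Γ := Γ) hl
  have aux : ∀ T : RealPlane, ∃ a : Module.Dual ℝ (Fin 3 → ℝ), a T.rep = 0 ∧
      ∃ w, l w = 0 ∧ a w ≠ 0 ∧ ∀ c : ℝ, w ≠ c • T.rep := fun T => by
    obtain ⟨w, hlw, hw⟩ := exists_mem_ker_not_smul (l := l) T.rep
    obtain ⟨a, ha, ha'⟩ := exists_dual_eq_zero_ne_zero hw
    exact ⟨a, ha, w, hlw, ha', hw⟩
  obtain ⟨a, ha, w, hlw, haw, hw⟩ := aux P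
  obtain ⟨b, hb, w', hlw', hbw', -⟩ := aux Q
  obtain ⟨A, A', hA, hFA⟩ := exists_eq_mul_add_mul P.rep_nonzero hl hlP ha ⟨w, hlw, haw⟩
    Γ.homogeneous hP.1
  have hAQ : eval Q.rep A = 0 := by
    by_cases hPQ : P = Q
    -- On the tangent the form has order at least 2 at `P`; removing `a` leaves order at least 1.
    · subst hPQ
      have h1 : ordAlong (lineArc P.rep w) Γ.form = 1 + ordAlong (lineArc P.rep w) A := by
        rw [hFA, ordAlong_lineArc_add_mul hlP hlw, ordAlong_mul,
          ordAlong_lineArc_linForm hl ⟨w, hlw, haw⟩ hlP ha hlP hlw hw, pointMult, if_pos rfl,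
          Nat.cast_one]
      have h2 : ((2 : ℕ) : ℕ∞) ≤ ordAlong (lineArc P.rep w) Γ.form := by
        refine PowerSeries.nat_le_order _ _ fun i hi => ?_
        interval_cases i
        · rw [PowerSeries.coeff_zero_eq_constantCoeff_apply, constantCoeff_aeval,
            funext (constantCoeff_lineArc _ _)]
          exact hP.1
        · rw [coeff_one_aeval_lineArc, ← htan rfl, hlw]
      rw [h1, show ((2 : ℕ) : ℕ∞) = 1 + 1 by norm_num,
        ENat.add_le_add_iff_left (by simp)] at h2
      exact (one_le_ordAlong (constantCoeff_lineArc _ _) A).1 h2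
    · have h1 : eval Q.rep Γ.form = 0 := hQ.1
      rw [hFA] at h1
      simp only [map_add, map_mul, eval_linForm, hlQ, zero_mul, add_zero, mul_eq_zero] at h1
      refine h1.resolve_left fun haQ => hPQ ?_
      exact (RealPlane.eq_of_dual hl ⟨w, hlw, haw⟩ hlP ha hlQ haQ).symm
  obtain ⟨B, B', hB, hAB⟩ := exists_eq_mul_add_mul Q.rep_nonzero hl hlQ hb ⟨w', hlw', hbw'⟩ hA hAQ
  obtain ⟨c, rfl⟩ := exists_linForm_eq hB
  obtain ⟨r, hr0, hlr, hcr⟩ : ∃ r : Fin 3 → ℝ, r ≠ 0 ∧ l r = 0 ∧ c r = 0 := by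
    have hker : ¬ Function.Injective (l.prod c) := fun hinj => by
      have := LinearMap.finrank_le_finrank_of_injective hinj
      simp at this
    rw [← LinearMap.ker_eq_bot, Submodule.eq_bot_iff] at hker
    push Not at hker
    obtain ⟨r, hr, hr0⟩ := hker
    have := LinearMap.mem_ker.1 hr
    simp at this
    exact ⟨r, hr0, this⟩
  obtain ⟨u, hu⟩ := Projectivization.exists_smul_eq_mk_rep ℝ r hr0
  refine ⟨l, Projectivization.mk ℝ r hr0, hl, hlP, hlQ, ?_, ⟨v₀, hv₀, hv₀'⟩, a, b, c, ha, hb, ?_,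
    fun v hv => ?_⟩
  · rw [← hu, Units.smul_def, map_smul, hlr, smul_zero]
  · rw [← hu, Units.smul_def, map_smul, hcr, smul_zero]
  · rw [hFA, hAB]
    simp [eval_linForm, hv]
    ring

end PlaneCubic

/-! ### Uniqueness of the third point and the medial law -/

namespace PlaneCubic

variable {Γ : PlaneCubic} {l : Module.Dual ℝ (Fin 3 → ℝ)} {P Q R : RealPlane}

theorem pointMult_self (P : RealPlane) : pointMult P P = 1 := if_pos rfl

theorem IsSection.exists_differential_eq_smul (h : Γ.IsSection l P P R)
    (hP : P ∈ Γ.regularPoints) : ∃ c : ℝ, c ≠ 0 ∧ differential Γ.form P.rep = c • l := by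
  obtain ⟨c, hc⟩ := exists_eq_smul_of_ker_le fun v hv => h.differential_apply_eq_zero hv
  refine ⟨c, ?_, hc⟩
  rintro rfl
  exact differential_ne_zero hP (by rw [hc, zero_smul])

theorem exists_eq_smul_of_ne (hl : l ≠ 0) (hPQ : P ≠ Q) (hP : l P.rep = 0) (hQ : l Q.rep = 0)
    {d : Module.Dual ℝ (Fin 3 → ℝ)} (hdP : d P.rep = 0) (hdQ : d Q.rep = 0) :
    ∃ c : ℝ, d = c • l := by
  refine exists_eq_smul_of_ker_le fun v hv => ?_
  by_contra hdv
  exact hPQ (RealPlane.eq_of_dual hl ⟨v, hv, hdv⟩ hQ hdQ hP hdP)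

theorem IsSection.exists_eq_smul {l' : Module.Dual ℝ (Fin 3 → ℝ)} {R' : RealPlane}
    (h : Γ.IsSection l P Q R) (h' : Γ.IsSection l' P Q R') (hP : P ∈ Γ.regularPoints) :
    ∃ c : ℝ, c ≠ 0 ∧ l' = c • l := by
  by_cases hPQ : P = Q
  · subst hPQ
    obtain ⟨c, hc, e⟩ := h.exists_differential_eq_smul hP
    obtain ⟨c', hc', e'⟩ := h'.exists_differential_eq_smul hP
    refine ⟨c'⁻¹ * c, mul_ne_zero (inv_ne_zero hc') hc, ?_⟩
    rw [mul_smul, ← e, e', inv_smul_smul₀ hc']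
  · obtain ⟨c, hc⟩ := exists_eq_smul_of_ne h.ne_zero hPQ h.apply_fst h.apply_snd h'.apply_fst
      h'.apply_snd
    refine ⟨c, ?_, hc⟩
    rintro rfl
    exact h'.ne_zero (by rw [hc, zero_smul])

theorem IsSection.mult_eq {c : ℝ} (hc : c ≠ 0) {P' Q' R' T : RealPlane}
    (h : Γ.IsSection l P Q R) (h' : Γ.IsSection (c • l) P' Q' R') (hT : T ∈ Γ.regularPoints) :
    pointMult P T + pointMult Q T + pointMult R T =
      pointMult P' T + pointMult Q' T + pointMult R' T := by
  obtain ⟨γ, hγ⟩ := exists_branch hT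
  have h1 := h.ordAlong_branch hγ
  have h2 := h'.ordAlong_branch hγ
  rw [ordAlong_linForm_smul γ hc, h1] at h2
  exact_mod_cast h2

theorem eq_of_pointMult_eq_one {T : RealPlane} (h : pointMult P T = 1) : T = P := by
  by_contra hne
  rw [pointMult, if_neg hne] at h
  exact zero_ne_one h

theorem IsSection.thd_unique {l' : Module.Dual ℝ (Fin 3 → ℝ)} {R' : RealPlane}
    (h : Γ.IsSection l P Q R) (h' : Γ.IsSection l' P Q R') (hP : P ∈ Γ.regularPoints)
    (hQ : Q ∈ Γ.regularPoints) : R = R' := by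
  obtain ⟨c, hc, rfl⟩ := h.exists_eq_smul h' hP
  have := h.mult_eq hc h' (h.regular_thd hP hQ)
  rw [pointMult_self] at this
  exact eq_of_pointMult_eq_one (by omega)

/-- With `t` the tangent at `X`, the product l₁l₂l₃t has divisor (A+B+E)+(C+D+F)+(G+H+Y)+(2X+V).
Division by l₄, l₅, l₆ removes A+C+G, B+D+H and E+F+X, the last being available thanks to `t`. This
leaves a line `d` with divisor Y+X+V. If X ≠ Y, then `d` is proportional to `t`, yet has smaller
order at `X`. -/
theorem IsSection.eq_of_medial {A B C D E F G H X Y : RealPlane}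
    {l₁ l₂ l₃ l₄ l₅ l₆ : Module.Dual ℝ (Fin 3 → ℝ)}
    (hA : A ∈ Γ.regularPoints) (hB : B ∈ Γ.regularPoints) (hC : C ∈ Γ.regularPoints)
    (hD : D ∈ Γ.regularPoints) (h₁ : Γ.IsSection l₁ A B E) (h₂ : Γ.IsSection l₂ C D F)
    (h₃ : Γ.IsSection l₃ G H Y) (h₄ : Γ.IsSection l₄ A C G) (h₅ : Γ.IsSection l₅ B D H)
    (h₆ : Γ.IsSection l₆ E F X) : X = Y := by
  classical
  have hE := h₁.regular_thd hA hB
  have hF := h₂.regular_thd hC hD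
  have hG := h₄.regular_thd hA hC
  have hH := h₅.regular_thd hB hD
  have hX := h₆.regular_thd hE hF
  have hY := h₃.regular_thd hG hH
  obtain ⟨t, V, ht⟩ := exists_isSection hX hX
  have hV := ht.regular_thd hX hX
  have hbr : ∀ T : RealPlane, ∃ γ, T ∈ Γ.regularPoints → IsBranch Γ.form T.rep γ := fun T => by
    by_cases hT : T ∈ Γ.regularPoints
    · obtain ⟨γ, hγ⟩ := exists_branch hT
      exact ⟨γ, fun _ => hγ⟩
    · exact ⟨0, fun h => absurd h hT⟩
  choose γ hγ using hbr
  obtain ⟨H₁, hH₁, hord₁⟩ := h₄.exists_quotient hA hC hG hγ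
    (((isHomogeneous_linForm l₁).mul (isHomogeneous_linForm l₂)).mul
      ((isHomogeneous_linForm l₃).mul (isHomogeneous_linForm t)))
    (m := fun T => pointMult B T + pointMult D T + pointMult H T + (pointMult E T + pointMult F T +
      pointMult X T + (pointMult Y T + pointMult X T + pointMult V T)))
    (fun T hT => by
      rw [ordAlong_mul, ordAlong_mul, ordAlong_mul, h₁.ordAlong_branch (hγ T hT),
        h₂.ordAlong_branch (hγ T hT), h₃.ordAlong_branch (hγ T hT), ht.ordAlong_branch (hγ T hT)]
      norm_cast
      omega)
  obtain ⟨H₂, hH₂, hord₂⟩ := h₅.exists_quotient hB hD hH hγ hH₁ hord₁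
  obtain ⟨H₃, hH₃, hord₃⟩ := h₆.exists_quotient hE hF hX hγ hH₂ hord₂
  -- Three divisions have lowered the degree from 4 to 1.
  obtain ⟨d, rfl⟩ := exists_linForm_eq hH₃
  have hd : d ≠ 0 := by
    rintro rfl
    have := hord₃ X hX
    simp [ordAlong, linForm] at this
    exact ENat.natCast_ne_top _ (by exact_mod_cast this.symm)
  have hvanish : ∀ T ∈ Γ.regularPoints,
      1 ≤ pointMult Y T + pointMult X T + pointMult V T → d T.rep = 0 := fun T hT h => by
    rw [← eval_linForm, ← one_le_ordAlong (hγ T hT).constantCoeff_eq, hord₃ T hT]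
    exact_mod_cast h
  have hdX : d X.rep = 0 := hvanish X hX (by rw [pointMult_self]; omega)
  by_contra hXY
  have hXY' : pointMult Y X = 0 := if_neg hXY
  obtain ⟨c, hc, hdt⟩ : ∃ c : ℝ, c ≠ 0 ∧ d = c • t := by
    suffices ∃ c : ℝ, d = c • t by
      obtain ⟨c, hc⟩ := this
      refine ⟨c, ?_, hc⟩
      rintro rfl
      exact hd (by rw [hc, zero_smul])
    by_cases hXV : X = V
    · subst hXV
      -- At an inflection point `X`, `d` has order 2 and `t` order 3. Hence `t` vanishes to order at
      -- least 2 along the line `d = 0`, so on all of it.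
      obtain ⟨w, hdw, hw, -, hle⟩ := (hγ X hX).exists_lineArc d hd hdX
      have h2 := hle (linForm t) (by
        rw [hord₃ X hX, ht.ordAlong_branch (hγ X hX), hXY']
        norm_cast
        omega)
      rw [hord₃ X hX, hXY', pointMult_self] at h2
      have htw : t w = 0 := by
        have h3 := PowerSeries.coeff_of_lt_order (φ := aeval (lineArc X.rep w) (linForm t)) 1
          (lt_of_lt_of_le (by norm_cast) h2)
        rwa [aeval_lineArc_linForm, map_add, PowerSeries.coeff_C, if_neg one_ne_zero,
          PowerSeries.coeff_C_mul, PowerSeries.coeff_one_X, mul_one, zero_add] at h3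
      refine exists_eq_smul_of_ker_le fun v hv => ?_
      by_contra hdv
      obtain ⟨k, hk⟩ := _root_.exists_eq_smul X.rep_nonzero ht.ne_zero ht.apply_fst hdX
        ⟨v, hv, hdv⟩ htw hdw
      exact hw k hk
    · exact exists_eq_smul_of_ne ht.ne_zero hXV ht.apply_fst ht.apply_thd hdX
        (hvanish V hV (by rw [pointMult_self]; omega))
  -- The order at `X` would be both 1 + [V = X] and 2 + [V = X].
  have h1 := hord₃ X hX
  rw [hdt, ordAlong_linForm_smul _ hc, ht.ordAlong_branch (hγ X hX), hXY', pointMult_self] at h1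
  norm_cast at h1
  omega

/-- The third intersection point of a line with the cubic, as an operation on regular points. -/
noncomputable def third (P Q : Γ.regularPoints) : Γ.regularPoints :=
  ⟨(exists_isSection P.2 Q.2).choose_spec.choose,
    (exists_isSection P.2 Q.2).choose_spec.choose_spec.regular_thd P.2 Q.2⟩

theorem exists_isSection_third (P Q : Γ.regularPoints) :
    ∃ l, Γ.IsSection l P Q (third P Q) :=
  ⟨_, (exists_isSection P.2 Q.2).choose_spec.choose_spec⟩

theorem IsSection.third_eq {P Q R : Γ.regularPoints} (h : Γ.IsSection l P Q R) :
    third P Q = R := by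
  obtain ⟨l', h'⟩ := exists_isSection_third P Q
  exact Subtype.ext (h'.thd_unique h P.2 Q.2)

theorem third_comm (P Q : Γ.regularPoints) : third P Q = third Q P := by
  obtain ⟨l, h⟩ := exists_isSection_third Q P
  exact h.swap.third_eq

theorem third_third (P Q : Γ.regularPoints) : third P (third P Q) = Q := by
  obtain ⟨l, h⟩ := exists_isSection_third P Q
  exact h.rotate.rotate.swap.third_eq

theorem third_left_cancel {P Q R : Γ.regularPoints} (h : third P Q = third P R) : Q = R := by
  rw [← third_third P Q, h, third_third]

theorem third_medial (A B C D : Γ.regularPoints) :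
    third (third A B) (third C D) = third (third A C) (third B D) := by
  obtain ⟨_, h₁⟩ := exists_isSection_third A B
  obtain ⟨_, h₂⟩ := exists_isSection_third C D
  obtain ⟨_, h₃⟩ := exists_isSection_third (third A C) (third B D)
  obtain ⟨_, h₄⟩ := exists_isSection_third A C
  obtain ⟨_, h₅⟩ := exists_isSection_third B D
  obtain ⟨_, h₆⟩ := exists_isSection_third (third A B) (third C D)
  exact Subtype.ext (IsSection.eq_of_medial A.2 B.2 C.2 D.2 h₁ h₂ h₃ h₄ h₅ h₆)

theorem third_self_eq {P Q P' Q' : Γ.regularPoints} (h : third P Q = third P' Q')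
    (h' : third P Q' = third P' Q) : third P P = third P' P' := by
  refine third_left_cancel (P := third Q Q') ?_
  rw [third_comm _ (third P P), third_comm _ (third P' P'), third_medial, h, h', third_medial P' P',
    third_comm (third P' Q')]

theorem third_eq_of_third_self_eq {P Q P' : Γ.regularPoints} (h : third P P = third P' P') :
    third P (third (third P Q) P') = third P' Q := by
  set Q' := third (third P Q) P' with hQ'
  have h1 : third P' Q' = third P Q := by rw [hQ', third_comm _ P', third_third]
  refine third_left_cancel (P := third P P') ?_
  rw [third_medial, h, h1, third_comm P P', third_medial]

/-! ### From sections to `line`, `IsSharp` and `IsMeet` -/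

theorem line_eq_ker_of_ne (hPQ : P ≠ Q) (hl : l ≠ 0) (hP : l P.rep = 0) (hQ : l Q.rep = 0) :
    Γ.line P Q = LinearMap.ker l := by
  rw [line, if_neg hPQ, Projectivization.submodule_eq, Projectivization.submodule_eq]
  apply le_antisymm
  · rw [sup_le_iff, Submodule.span_singleton_le_iff_mem, Submodule.span_singleton_le_iff_mem]
    exact ⟨hP, hQ⟩
  · intro v hv
    obtain ⟨a, haP, haQ⟩ := exists_dual_eq_zero_ne_zero (p := P.rep) (w := Q.rep)
      fun c hc => hPQ (RealPlane.eq_of_rep_eq_smul hc).symm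
    have hv' : l v = 0 := hv
    obtain ⟨k, hk⟩ := _root_.exists_eq_smul (q := v - (a v / a Q.rep) • Q.rep) P.rep_nonzero hl hP
      haP ⟨_, hQ, haQ⟩ (by simp [hv', hQ]) (by simp [haQ])
    rw [sub_eq_iff_eq_add.1 hk]
    exact Submodule.add_mem_sup (Submodule.smul_mem _ _ (Submodule.mem_span_singleton_self _))
      (Submodule.smul_mem _ _ (Submodule.mem_span_singleton_self _))

theorem line_self (P : RealPlane) :
    Γ.line P P = LinearMap.ker (differential Γ.form P.rep) := by
  rw [line, if_pos rfl]; rfl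

theorem ker_smul_eq {c : ℝ} (hc : c ≠ 0) : LinearMap.ker (c • l) = LinearMap.ker l := by
  ext v; simp [hc]

theorem IsSection.line_eq (h : Γ.IsSection l P Q R) (hP : P ∈ Γ.regularPoints) :
    Γ.line P Q = LinearMap.ker l := by
  by_cases hPQ : P = Q
  · subst hPQ
    obtain ⟨c, hc, e⟩ := h.exists_differential_eq_smul hP
    rw [line_self, e, ker_smul_eq hc]
  · exact line_eq_ker_of_ne hPQ h.ne_zero h.apply_fst h.apply_snd

theorem rep_mem_iff {L : Submodule ℝ (Fin 3 → ℝ)} : R.submodule ≤ L ↔ R.rep ∈ L := by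
  rw [Projectivization.submodule_eq, Submodule.span_singleton_le_iff_mem]

theorem IsSection.isSharp (h : Γ.IsSection l P Q R) (hP : P ∈ Γ.regularPoints) :
    Γ.IsSharp P Q R := by
  rw [IsSharp, h.line_eq hP]
  exact ⟨rep_mem_iff.2 h.apply_thd, h.exists_eval_ne_zero, h.exists_factors⟩

theorem IsSharp.exists_isSection (h : Γ.IsSharp P Q R) (hP : P ∈ Γ.regularPoints) :
    ∃ l, Γ.IsSection l P Q R := by
  obtain ⟨l, hl, hlP, hlQ, htan⟩ := exists_dual_line (Q := Q) hP
  have hline : Γ.line P Q = LinearMap.ker l := by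
    by_cases hPQ : P = Q
    · rw [htan hPQ, ← hPQ, line_self]
    · exact line_eq_ker_of_ne hPQ hl hlP hlQ
  rw [IsSharp, hline] at h
  exact ⟨l, hl, hlP, hlQ, rep_mem_iff.1 h.1, h.2.1, h.2.2⟩

theorem IsSharp.regular (h : Γ.IsSharp P Q R) (hP : P ∈ Γ.regularPoints)
    (hQ : Q ∈ Γ.regularPoints) : R ∈ Γ.regularPoints := by
  obtain ⟨l, hl⟩ := h.exists_isSection hP
  exact hl.regular_thd hP hQ

theorem isSharp_iff_third_eq {P Q R : Γ.regularPoints} :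
    Γ.IsSharp P Q R ↔ third P Q = R := by
  constructor
  · intro h
    obtain ⟨l, hl⟩ := h.exists_isSection P.2
    exact hl.third_eq
  · rintro rfl
    obtain ⟨l, hl⟩ := exists_isSection_third P Q
    exact hl.isSharp P.2

/-- A point of the cubic on the line is a zero of one of the three linear factors, hence `P`, `Q` or
the third point. -/
theorem isSharp_of_distinct (hP : P ∈ Γ.regularPoints) (hQ : Q ∈ Γ.regularPoints)
    (hR : R ∈ Γ.points) (hRP : R ≠ P) (hRQ : R ≠ Q)
    (hmem : R.submodule ≤ Γ.line P Q) : Γ.IsSharp P Q R := by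
  obtain ⟨l, T, h⟩ := exists_isSection hP hQ
  have hlR : l R.rep = 0 := by
    rw [h.line_eq hP, rep_mem_iff] at hmem
    exact hmem
  obtain ⟨a, b, c, K, ha, hb, hc, ha', hb', hc', hF⟩ := h.exists_form_eq
  have h0 : eval R.rep Γ.form = 0 := hR
  simp only [hF, map_add, map_mul, eval_linForm, hlR, zero_mul, add_zero, mul_eq_zero] at h0
  obtain rfl : R = T := by
    rcases h0 with (h0 | h0) | h0
    · exact absurd (RealPlane.eq_of_dual h.ne_zero ha' h.apply_fst ha hlR h0) hRP
    · exact absurd (RealPlane.eq_of_dual h.ne_zero hb' h.apply_snd hb hlR h0) hRQ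
    · exact RealPlane.eq_of_dual h.ne_zero hc' h.apply_thd hc hlR h0
  exact h.isSharp hP

theorem isSharp_of_isMeet {S P' Q' : RealPlane} (hP : P ∈ Γ.regularPoints)
    (hQ : Q ∈ Γ.regularPoints) (hP' : P' ∈ Γ.regularPoints) (hQ' : Q' ∈ Γ.regularPoints)
    (hmeet : IsMeet (Γ.line P Q) (Γ.line P' Q') S)
    (hS : S ∈ Γ.points)
    (h : S = P ∨ S = Q ∨ S = P' ∨ S = Q' → Γ.IsSharp P Q S ∧ Γ.IsSharp P' Q' S) :
    Γ.IsSharp P Q S ∧ Γ.IsSharp P' Q' S := by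
  by_cases hmem : S = P ∨ S = Q ∨ S = P' ∨ S = Q'
  · exact h hmem
  · push Not at hmem
    obtain ⟨h1, h2, h3, h4⟩ := hmem
    exact ⟨isSharp_of_distinct hP hQ hS h1 h2 (hmeet ▸ inf_le_left),
      isSharp_of_distinct hP' hQ' hS h3 h4 (hmeet ▸ inf_le_right)⟩

/-- If the lines coincided, the sections P+Q'+S and P'+Q+S would be equal, but `P` has greater
multiplicity in the first. -/
theorem isMeet_of_isSharp {P' Q' S : RealPlane} (hP : P ∈ Γ.regularPoints)
    (hP' : P' ∈ Γ.regularPoints) (h : Γ.IsSharp P Q' S)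
    (h' : Γ.IsSharp P' Q S) (hPP' : P ≠ P') (hQP : Q ≠ P) :
    IsMeet (Γ.line P Q') (Γ.line P' Q) S := by
  obtain ⟨l, hl⟩ := h.exists_isSection hP
  obtain ⟨l', hl'⟩ := h'.exists_isSection hP'
  rw [IsMeet, hl.line_eq hP, hl'.line_eq hP']
  apply le_antisymm
  · intro v hv
    obtain ⟨hv1, hv2⟩ := Submodule.mem_inf.1 hv
    have hne : ∃ u, l u = 0 ∧ l' u ≠ 0 := by
      by_contra! hker
      obtain ⟨c, rfl⟩ := exists_eq_smul_of_ker_le hker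
      have hc : c ≠ 0 := by
        rintro rfl
        exact hl'.ne_zero (zero_smul _ _)
      have := hl.mult_eq hc hl' hP
      rw [pointMult_self, pointMult, pointMult, pointMult, pointMult, if_neg hPP',
        if_neg hQP.symm] at this
      omega
    obtain ⟨k, hk⟩ := _root_.exists_eq_smul S.rep_nonzero hl.ne_zero hl.apply_thd hl'.apply_thd hne
      hv1 hv2
    rw [Projectivization.submodule_eq, hk]
    exact Submodule.smul_mem _ _ (Submodule.mem_span_singleton_self _)
  · rw [rep_mem_iff]
    exact ⟨hl.apply_thd, hl'.apply_thd⟩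

end PlaneCubic

theorem lemma4 (Γ : PlaneCubic) :
    -- (a)
    (∀ P Q P' Q' S S' : RealPlane,
      P ∈ Γ.regularPoints → Q ∈ Γ.regularPoints →
      P' ∈ Γ.regularPoints → Q' ∈ Γ.regularPoints →
      P ≠ Q → P ≠ P' → P ≠ Q' → Q ≠ P' → Q ≠ Q' → P' ≠ Q' →
      IsMeet (Γ.line P Q) (Γ.line P' Q') S → S ∈ Γ.points →
      IsMeet (Γ.line P Q') (Γ.line P' Q) S' → S' ∈ Γ.points →
      -- a meet that is one of the four points counts as third intersection point of both lines
      (S ∈ ({P, Q, P', Q'} : Set RealPlane) → Γ.IsSharp P Q S ∧ Γ.IsSharp P' Q' S) →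
      (S' ∈ ({P, Q, P', Q'} : Set RealPlane) → Γ.IsSharp P Q' S' ∧ Γ.IsSharp P' Q S') →
      (∃ X ∈ Γ.points, Γ.IsSharp P P X ∧ Γ.IsSharp P' P' X) ∧
      (∃ Y ∈ Γ.points, Γ.IsSharp Q Q Y ∧ Γ.IsSharp Q' Q' Y) ∧
      (∃ Z ∈ Γ.points, S ∈ Γ.regularPoints ∧ S' ∈ Γ.regularPoints ∧
        Γ.IsSharp S S Z ∧ Γ.IsSharp S' S' Z)) ∧
    -- (b)
    (∀ P P' X : RealPlane,
      P ∈ Γ.regularPoints → P' ∈ Γ.regularPoints →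
      Γ.IsSharp P P X → Γ.IsSharp P' P' X →
      ∀ Q ∈ Γ.regularPoints, ∀ S Q' : RealPlane,
        Γ.IsSharp P Q S → Γ.IsSharp S P' Q' →
        (∃ S' ∈ Γ.points, Γ.IsSharp P Q' S' ∧ Γ.IsSharp P' Q S' ∧
          (P ≠ P' → Q ≠ P → IsMeet (Γ.line P Q') (Γ.line P' Q) S')) ∧
        (∃ Y ∈ Γ.points, Q' ∈ Γ.regularPoints ∧ Γ.IsSharp Q Q Y ∧ Γ.IsSharp Q' Q' Y)) := by
  refine ⟨?_, ?_⟩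
  · intro P Q P' Q' S S' hP hQ hP' hQ' _ _ _ _ _ _ hmeet hS hmeet' hS' h h'
    obtain ⟨h1, h2⟩ := PlaneCubic.isSharp_of_isMeet hP hQ hP' hQ' hmeet hS (by simpa using h)
    obtain ⟨h3, h4⟩ := PlaneCubic.isSharp_of_isMeet hP hQ' hP' hQ hmeet' hS' (by
      rintro (hm | hm | hm | hm) <;> exact h' (by simp [hm]))
    have hSreg := h1.regular hP hQ
    have hSreg' := h3.regular hP hQ'
    lift P to Γ.regularPoints using hP
    lift Q to Γ.regularPoints using hQ
    lift P' to Γ.regularPoints using hP'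
    lift Q' to Γ.regularPoints using hQ'
    lift S to Γ.regularPoints using hSreg
    lift S' to Γ.regularPoints using hSreg'
    rw [PlaneCubic.isSharp_iff_third_eq] at h1 h2 h3 h4
    have eP := PlaneCubic.third_self_eq (h1.trans h2.symm) (h3.trans h4.symm)
    have eQ := PlaneCubic.third_self_eq (P := Q) (Q := P) (P' := Q') (Q' := P')
      (by rw [PlaneCubic.third_comm Q, h1, PlaneCubic.third_comm Q', h2])
      (by rw [PlaneCubic.third_comm Q, h4, PlaneCubic.third_comm Q', h3])
    have eS : PlaneCubic.third S S = PlaneCubic.third S' S' := by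
      nth_rewrite 1 [← h1]
      nth_rewrite 1 [← h3]
      rw [← h2, ← h4, PlaneCubic.third_medial, PlaneCubic.third_medial P Q',
        PlaneCubic.third_comm Q Q']
    exact ⟨⟨_, (PlaneCubic.third P P).2.1, PlaneCubic.isSharp_iff_third_eq.2 rfl,
        PlaneCubic.isSharp_iff_third_eq.2 eP.symm⟩,
      ⟨_, (PlaneCubic.third Q Q).2.1, PlaneCubic.isSharp_iff_third_eq.2 rfl,
        PlaneCubic.isSharp_iff_third_eq.2 eQ.symm⟩,
      ⟨_, (PlaneCubic.third S S).2.1, S.2, S'.2, PlaneCubic.isSharp_iff_third_eq.2 rfl,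
        PlaneCubic.isSharp_iff_third_eq.2 eS.symm⟩⟩
  · intro P P' X hP hP' hX hX' Q hQ S Q' hS hQ'
    have hXreg := hX.regular hP hP
    have hSreg := hS.regular hP hQ
    have hQreg' := hQ'.regular hSreg hP'
    lift P to Γ.regularPoints using hP
    lift Q to Γ.regularPoints using hQ
    lift P' to Γ.regularPoints using hP'
    lift X to Γ.regularPoints using hXreg
    lift S to Γ.regularPoints using hSreg
    lift Q' to Γ.regularPoints using hQreg'
    rw [PlaneCubic.isSharp_iff_third_eq] at hX hX' hS hQ'
    subst hS hQ'
    have e := PlaneCubic.third_eq_of_third_self_eq (Q := Q) (hX.trans hX'.symm)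
    have eS : PlaneCubic.third P' (PlaneCubic.third (PlaneCubic.third P Q) P') =
        PlaneCubic.third P Q := by
      rw [PlaneCubic.third_comm _ P', PlaneCubic.third_third]
    -- The identity behind (a) with the pairs exchanged: Q#P = Q'#P' and Q#P' = Q'#P.
    have eQ := PlaneCubic.third_self_eq (P := Q) (Q := P)
      (P' := PlaneCubic.third (PlaneCubic.third P Q) P') (Q' := P')
      (by rw [PlaneCubic.third_comm Q, PlaneCubic.third_comm _ P', eS])
      (by rw [PlaneCubic.third_comm Q, PlaneCubic.third_comm _ P, e])
    have h1 := PlaneCubic.isSharp_iff_third_eq.2 e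
    have h2 := PlaneCubic.isSharp_iff_third_eq.2 (rfl : PlaneCubic.third P' Q = _)
    exact ⟨⟨_, (PlaneCubic.third P' Q).2.1, h1, h2, fun hne hne' =>
        PlaneCubic.isMeet_of_isSharp P.2 P'.2 h1 h2 hne hne'⟩,
      ⟨_, (PlaneCubic.third Q Q).2.1, Subtype.prop _, PlaneCubic.isSharp_iff_third_eq.2 rfl,
        PlaneCubic.isSharp_iff_third_eq.2 eQ.symm⟩⟩
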